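/- For complex numbers $x,q$ with $|q|<1$ write $(x;q)_n=\prod_{k=0}^{n-1}(1-xq^k)$, $(x;q)_\infty=\prod_{k=0}^{\infty}(1-xq^k)$, and $(x_1,\dots,x_m;q)_n=(x_1;q)_n\cdots(x_m;q)_n$ for $n\in\{0,1,2,\dots\}\cup\{\infty\}$. **Theorem.** Let $q,a,b\in\mathbb C$ with $|q|<1$ and $\max\{|aq^2|,|bq^2|,|ab|\}<1$. Then the three series below converge absolutely and $$ \begin{aligned} &\frac{(q^4,ab;q^2)_\infty}{(-q^2,aq^2,bq^2;q^2)_\infty\,(q^2;q^4)_\infty} \sum_{n=0}^{\infty}\frac{(q^2/a,q^2/b;q^2)_n}{(q^2,q^3,-q^3;q^2)_n}\,a^nb^n\\ &\quad=\sum_{n=0}^{\infty}(-1)^n\frac{(q^2/a,q^2/b;q^2)_{2n}}{(aq^2,bq^2;q^2)_{2n}}\,a^{2n}b^{2n}q^{6n^2+2n} -\sum_{n=0}^{\infty}(-1)^n\frac{(q^2/a,q^2/b;q^2)_{2n+1}}{(aq^2,bq^2;q^2)_{2n+1}}\,a^{2n+1}b^{2n+1}q^{6n^2+10n+4}. \end{aligned}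 $$ Here, if $a=0$, the product $(q^2/a;q^2)_m\,a^m$ is understood as its limit $(-1)^mq^{m(m+1)}$ as $a\to0$, and likewise for $b=0$; also $0^0=1$. -/

import Mathlib

/-- The finite `q`-shifted factorial `(a; q)_n = ∏_{k=0}^{n-1} (1 - a q^k)`. -/
noncomputable def qPoch (a q : ℂ) (n : ℕ) : ℂ :=
  ∏ k ∈ Finset.range n, (1 - a * q ^ k)

/-- The infinite `q`-shifted factorial `(a; q)_∞ = ∏_{k=0}^∞ (1 - a q^k)`. -/
noncomputable def qPochInf (a q : ℂ) : ℂ :=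
  ∏' k : ℕ, (1 - a * q ^ k)

/-- For `|q| < 1` the infinite product `(a; q)_∞` converges. -/
theorem multipliable_qPochInf (a : ℂ) {q : ℂ} (hq : ‖q‖ < 1) :
    Multipliable (fun k : ℕ => 1 - a * q ^ k) := by
  have h : Summable (fun k : ℕ => ‖-(a * q ^ k)‖) := by
    simpa using (summable_geometric_of_lt_one (norm_nonneg q) hq).mul_left ‖a‖
  simpa [sub_eq_add_neg] using multipliable_one_add_of_summable h

/-- The quantity `(q²/a; q²)_n aⁿ`. At `a = 0` it stands for its limit as `a → 0`, which is
`(-1)ⁿ q^{n(n+1)}`. -/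
noncomputable def qPochPow (q a : ℂ) (n : ℕ) : ℂ :=
  if a = 0 then (-1) ^ n * q ^ (n * (n + 1)) else qPoch (q ^ 2 / a) (q ^ 2) n * a ^ n

/-- `(q²/a; q²)_n aⁿ = ∏_{k=0}^{n-1} (a - q^{2k+2})`, including the limiting value at `a = 0`. -/
theorem qPochPow_eq_prod (q a : ℂ) (n : ℕ) :
    qPochPow q a n = ∏ k ∈ Finset.range n, (a - q ^ (2 * k + 2)) := by
  unfold qPochPow
  split_ifs with h
  · subst h
    induction n with
    | zero => simp
    | succ n ih =>
      rw [Finset.prod_range_succ, ← ih]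
      ring
  · rw [qPoch, show a ^ n = ∏ _k ∈ Finset.range n, a by simp,
      ← Finset.prod_mul_distrib]
    refine Finset.prod_congr rfl fun k _ => ?_
    field_simp
    ring

/-- The value of `(q²/a; q²)_n aⁿ` used at `a = 0` is its limit as `a → 0`. -/
theorem tendsto_qPochPow_zero (q : ℂ) (n : ℕ) :
    Filter.Tendsto (fun a : ℂ => qPoch (q ^ 2 / a) (q ^ 2) n * a ^ n)
      (nhdsWithin 0 {0}ᶜ) (nhds ((-1) ^ n * q ^ (n * (n + 1)))) := by
  have hc : Continuous (fun a : ℂ => qPochPow q a n) := by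
    simp only [qPochPow_eq_prod]
    fun_prop
  have h := (hc.tendsto 0).mono_left (nhdsWithin_le_nhds (s := {0}ᶜ))
  have h0 : qPochPow q 0 n = (-1) ^ n * q ^ (n * (n + 1)) := if_pos rfl
  rw [h0] at h
  refine h.congr' ?_
  filter_upwards [self_mem_nhdsWithin] with a ha
  exact if_neg ha

open Filter Topology Finset

/-! Put p = q². The identity is Bailey's lemma in base p applied to one Bailey pair relative to p.
The products (q²/a; q²)_n aⁿ are handled as polynomials ∏ (a - p^(k+1)) (`homPoch`), so that a = 0
or b = 0 is no exception.

The pair has β_n = 1/((p;p)_n (p³;p²)_n), which is what the left-hand denominators become since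
(q³;q²)_n (-q³;q²)_n = (p³;p²)_n. Its α_r, for even and odd r, give the two series on the right.
Folding Σ_r α_r/((p;p)_(n-r) (p;p)_(n+r+1)) out over ℤ gives a bilateral sum, for which shift
relations and two reflections of the index yield a first-order recurrence in n
(`tsum_bilatTerm_one_rec`).

Inserting the pair into the left-hand series gives an absolutely convergent double series. Summed
the other way, each inner series is a q-Gauss sum (`tsum_gaussTerm`), which supplies the infinite
products (`bailey_transform`). Euler's identity in base p removes the remaining factor (-p;p)_∞
(p;p²)_∞. -/

theorem qPoch_succ (x q : ℂ) (n : ℕ) : qPoch x q (n + 1) = qPoch x q n * (1 - x * q ^ n) :=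
  prod_range_succ _ _

theorem qPoch_zero (x q : ℂ) : qPoch x q 0 = 1 := prod_range_zero _

theorem qPoch_add (x q : ℂ) (m n : ℕ) :
    qPoch x q (m + n) = qPoch x q m * qPoch (x * q ^ m) q n := by
  unfold qPoch
  rw [prod_range_add]
  congr 1
  exact prod_congr rfl fun k _ => by ring

theorem one_sub_ne_zero_of_norm_lt_one {z : ℂ} (hz : ‖z‖ < 1) : 1 - z ≠ 0 := by
  intro h
  rw [← sub_eq_zero.mp h] at hz
  simp at hz

theorem norm_mul_pow_lt_one {x q : ℂ} (hx : ‖x‖ < 1) (hq : ‖q‖ < 1) (k : ℕ) :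
    ‖x * q ^ k‖ < 1 := by
  rw [norm_mul, norm_pow]
  exact (mul_le_of_le_one_right (norm_nonneg _) (pow_le_one₀ (norm_nonneg _) hq.le)).trans_lt hx

theorem qPoch_ne_zero {x q : ℂ} (hx : ‖x‖ < 1) (hq : ‖q‖ < 1) (n : ℕ) : qPoch x q n ≠ 0 :=
  prod_ne_zero_iff.mpr fun k _ =>
    one_sub_ne_zero_of_norm_lt_one (norm_mul_pow_lt_one hx hq k)

theorem tendsto_qPoch (x : ℂ) {q : ℂ} (hq : ‖q‖ < 1) :
    Tendsto (qPoch x q) atTop (𝓝 (qPochInf x q)) :=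
  (multipliable_qPochInf x hq).hasProd.tendsto_prod_nat

theorem qPochInf_eq_qPoch_mul (x : ℂ) {q : ℂ} (hq : ‖q‖ < 1) (n : ℕ) :
    qPochInf x q = qPoch x q n * qPochInf (x * q ^ n) q := by
  have h1 : Tendsto (fun m => qPoch x q (n + m)) atTop (𝓝 (qPochInf x q)) := by
    simpa [add_comm] using (tendsto_add_atTop_iff_nat n).mpr (tendsto_qPoch x hq)
  simp only [qPoch_add] at h1
  exact tendsto_nhds_unique h1 ((tendsto_qPoch _ hq).const_mul _)

theorem qPochInf_ne_zero {x q : ℂ} (hx : ‖x‖ < 1) (hq : ‖q‖ < 1) : qPochInf x q ≠ 0 := by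
  have h : Summable (fun k : ℕ => ‖-(x * q ^ k)‖) := by
    simpa using (summable_geometric_of_lt_one (norm_nonneg q) hq).mul_left ‖x‖
  have := tprod_one_add_ne_zero_of_summable (f := fun k : ℕ => -(x * q ^ k))
    (fun k => by
      simpa [sub_eq_add_neg] using one_sub_ne_zero_of_norm_lt_one (norm_mul_pow_lt_one hx hq k)) h
  simpa [qPochInf, sub_eq_add_neg] using this

theorem exists_norm_inv_qPoch_le {x q : ℂ} (hx : ‖x‖ < 1) (hq : ‖q‖ < 1) :
    ∃ K, ∀ n, ‖(qPoch x q n)⁻¹‖ ≤ K := by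
  obtain ⟨K, hK⟩ := (((tendsto_qPoch x hq).inv₀ (qPochInf_ne_zero hx hq)).norm).bddAbove_range
  exact ⟨K, fun n => hK ⟨n, rfl⟩⟩

/-! ### Euler's identity -/

theorem qPoch_neg_mul_qPoch (q : ℂ) (n : ℕ) :
    qPoch (-q) q n * qPoch q q n = qPoch (q ^ 2) (q ^ 2) n := by
  simp only [qPoch, ← prod_mul_distrib]
  exact prod_congr rfl fun k _ => by ring

theorem qPoch_two_mul (q : ℂ) (n : ℕ) :
    qPoch q q (2 * n) = qPoch q (q ^ 2) n * qPoch (q ^ 2) (q ^ 2) n := by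
  induction n with
  | zero => simp [qPoch_zero]
  | succ n ih =>
    rw [show 2 * (n + 1) = 2 * n + 1 + 1 by ring, qPoch_succ, qPoch_succ, ih, qPoch_succ,
      qPoch_succ]
    ring

theorem norm_sq_lt_one {q : ℂ} (hq : ‖q‖ < 1) : ‖q ^ 2‖ < 1 := by
  rw [norm_pow]
  exact pow_lt_one₀ (norm_nonneg _) hq two_ne_zero

/-- Euler's identity `(-q; q)_∞ (q; q²)_∞ = 1`. -/
theorem qPochInf_neg_mul_qPochInf_sq {q : ℂ} (hq : ‖q‖ < 1) :
    qPochInf (-q) q * qPochInf q (q ^ 2) = 1 := by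
  have hq2 := norm_sq_lt_one hq
  have h1 : qPochInf (-q) q * qPochInf q q = qPochInf (q ^ 2) (q ^ 2) := by
    have := (tendsto_qPoch (-q) hq).mul (tendsto_qPoch q hq)
    simp only [qPoch_neg_mul_qPoch] at this
    exact tendsto_nhds_unique this (tendsto_qPoch _ hq2)
  have h2 : qPochInf q q = qPochInf q (q ^ 2) * qPochInf (q ^ 2) (q ^ 2) := by
    have := (tendsto_qPoch q hq).comp
      (tendsto_id.const_mul_atTop' (show 0 < 2 by norm_num))
    refine tendsto_nhds_unique this ?_
    simp only [Function.comp_def, id, qPoch_two_mul]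
    exact (tendsto_qPoch _ hq2).mul (tendsto_qPoch _ hq2)
  have h3 := qPochInf_ne_zero hq2 hq2
  rw [h2] at h1
  apply mul_right_cancel₀ h3
  linear_combination h1

/-! ### Homogeneous factorials and geometric bounds -/

/-- Past some N every new factor is at most s. The constant is the sum of the ratios (partial
product)/s^m for m ≤ N, hence at least each of them. -/
theorem exists_prod_le_geometric {g : ℕ → ℝ} (hg : ∀ k, 0 ≤ g k) {L s : ℝ}
    (h : Tendsto g atTop (𝓝 L)) (hs : 0 < s) (hLs : L < s) :
    ∃ C, ∀ n, ∏ k ∈ range n, g k ≤ C * s ^ n := by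
  obtain ⟨N, hN⟩ := eventually_atTop.mp (h.eventually (eventually_le_nhds hLs))
  have hpos : ∀ n, 0 ≤ (∏ k ∈ range n, g k) / s ^ n := fun n =>
    div_nonneg (prod_nonneg fun k _ => hg k) (pow_nonneg hs.le n)
  have key : ∀ n ≤ N, ∏ k ∈ range n, g k ≤
      (∑ m ∈ range (N + 1), (∏ k ∈ range m, g k) / s ^ m) * s ^ n := fun n hn => by
    rw [← div_le_iff₀ (pow_pos hs n)]
    exact single_le_sum (f := fun m => (∏ k ∈ range m, g k) / s ^ m) (fun m _ => hpos m)
      (mem_range.mpr (by omega))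
  refine ⟨∑ m ∈ range (N + 1), (∏ k ∈ range m, g k) / s ^ m, fun n => ?_⟩
  rcases le_total n N with hn | hn
  · exact key n hn
  · induction n, hn using Nat.le_induction with
    | base => exact key N le_rfl
    | succ n hn ih =>
      rw [prod_range_succ, pow_succ, ← mul_assoc]
      exact mul_le_mul ih (hN n hn) (hg n) ((prod_nonneg fun k _ => hg k).trans ih)

/-- The homogeneous `q`-shifted factorial `∏_{k<n} (a - c q^k) = (c/a; q)_n aⁿ`. -/
noncomputable def homPoch (c a q : ℂ) (n : ℕ) : ℂ := ∏ k ∈ range n, (a - c * q ^ k)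

theorem homPoch_succ (c a q : ℂ) (n : ℕ) :
    homPoch c a q (n + 1) = homPoch c a q n * (a - c * q ^ n) := prod_range_succ _ _

theorem homPoch_zero (c a q : ℂ) : homPoch c a q 0 = 1 := prod_range_zero _

theorem homPoch_add (c a q : ℂ) (m n : ℕ) :
    homPoch c a q (m + n) = homPoch c a q m * homPoch (c * q ^ m) a q n := by
  unfold homPoch
  rw [prod_range_add]
  congr 1
  exact prod_congr rfl fun k _ => by ring

/-- Every factor after the first is aq - c q^(k+1) = q (a - c q^k). -/
theorem homPoch_mul_succ (c a q : ℂ) (n : ℕ) :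
    homPoch c (a * q) q (n + 1) = q ^ n * (a * q - c) * homPoch c a q n := by
  induction n with
  | zero => simp [homPoch_succ, homPoch_zero]
  | succ n ih => rw [homPoch_succ, ih, homPoch_succ]; ring

theorem homPoch_self_succ (c q : ℂ) (n : ℕ) : homPoch c c q (n + 1) = 0 :=
  prod_eq_zero (mem_range.mpr n.succ_pos) (by simp)

theorem continuous_homPoch (c q : ℂ) (n : ℕ) : Continuous fun a => homPoch c a q n := by
  unfold homPoch
  fun_prop

/-- The paired factors have norms at most (A + ‖c‖‖q‖^k)(B + ‖c‖‖q‖^k), which tends to AB < 1.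
Uniformity in a and b is what later permits dominated convergence as a → 0. -/
theorem exists_norm_homPoch_mul_le {q : ℂ} (hq : ‖q‖ < 1) (c : ℂ) {A B : ℝ} (hA : 0 ≤ A)
    (hB : 0 ≤ B) (hAB : A * B < 1) :
    ∃ C s : ℝ, 0 < s ∧ s < 1 ∧ ∀ a b : ℂ, ‖a‖ ≤ A → ‖b‖ ≤ B → ∀ n,
      ‖homPoch c a q n * homPoch c b q n‖ ≤ C * s ^ n := by
  obtain ⟨s, hs1, hs2⟩ := exists_between hAB
  have hs0 : 0 < s := (mul_nonneg hA hB).trans_lt hs1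
  have ht : ∀ D : ℝ, Tendsto (fun k : ℕ => D + ‖c‖ * ‖q‖ ^ k) atTop (𝓝 D) := fun D => by
    simpa using ((tendsto_pow_atTop_nhds_zero_of_lt_one (norm_nonneg q) hq).const_mul
      ‖c‖).const_add D
  obtain ⟨C, hC⟩ := exists_prod_le_geometric (fun k => by positivity) ((ht A).mul (ht B)) hs0 hs1
  have hle : ∀ (D : ℝ) (a : ℂ), ‖a‖ ≤ D → ∀ k : ℕ, ‖a - c * q ^ k‖ ≤ D + ‖c‖ * ‖q‖ ^ k :=
    fun D a ha k => (norm_sub_le _ _).trans (by simpa using ha)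
  refine ⟨C, s, hs0, hs2, fun a b ha hb n => le_trans ?_ (hC n)⟩
  rw [homPoch, homPoch, ← prod_mul_distrib, norm_prod]
  refine prod_le_prod (fun _ _ => norm_nonneg _) fun k _ => ?_
  rw [norm_mul]
  exact mul_le_mul (hle A a ha k) (hle B b hb k) (norm_nonneg _) (by positivity)

/-! ### The q-Gauss sum -/

/-- The terms of the `q`-Gauss series in homogeneous form. -/
noncomputable def gaussTerm (c q a b : ℂ) (m : ℕ) : ℂ :=
  homPoch c a q m * homPoch c b q m / (qPoch q q m * qPoch (c ^ 2) q m)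

theorem exists_norm_gaussTerm_le {c q : ℂ} (hq : ‖q‖ < 1) (hc : ‖c‖ < 1) {A B : ℝ} (hA : 0 ≤ A)
    (hB : 0 ≤ B) (hAB : A * B < 1) :
    ∃ g : ℕ → ℝ, Summable g ∧ ∀ a b : ℂ, ‖a‖ ≤ A → ‖b‖ ≤ B → ∀ n,
      ‖gaussTerm c q a b n‖ ≤ g n := by
  obtain ⟨C, s, hs0, hs1, hC⟩ := exists_norm_homPoch_mul_le hq c hA hB hAB
  obtain ⟨K, hK⟩ := exists_norm_inv_qPoch_le hq hq
  obtain ⟨K', hK'⟩ := exists_norm_inv_qPoch_le (norm_sq_lt_one hc) hq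
  refine ⟨fun n => C * s ^ n * (K * K'),
    ((summable_geometric_of_lt_one hs0.le hs1).mul_left C).mul_right _, fun a b ha hb n => ?_⟩
  rw [gaussTerm, div_eq_mul_inv, mul_inv, norm_mul, norm_mul (qPoch q q n)⁻¹]
  have h1 := hC a b ha hb n
  have h2 := hK n
  exact mul_le_mul h1 (mul_le_mul h2 (hK' n) (norm_nonneg _) ((norm_nonneg _).trans h2))
    (by positivity) ((norm_nonneg _).trans h1)

theorem summable_gaussTerm {c q : ℂ} (hq : ‖q‖ < 1) (hc : ‖c‖ < 1) {a b : ℂ}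
    (hab : ‖a * b‖ < 1) : Summable (gaussTerm c q a b) := by
  rw [norm_mul] at hab
  obtain ⟨g, hg, h⟩ := exists_norm_gaussTerm_le hq hc (norm_nonneg a) (norm_nonneg b) hab
  exact hg.of_norm_bounded (h a b le_rfl le_rfl)

/-- A telescoping certificate for the contiguous relation a → aq; the boundary term on the right
vanishes as M → ∞ when ‖ab‖ < 1. -/
theorem sum_gaussTerm_telescope {c q : ℂ} (hq : ‖q‖ < 1) (hc : ‖c‖ < 1) (a b : ℂ) (M : ℕ) :
    ∑ m ∈ range (M + 1),
      ((1 - a * b) * gaussTerm c q a b m - (1 - a * c) * gaussTerm c q (a * q) b m) =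
    -a * (b - c * q ^ M) * gaussTerm c q a b M := by
  induction M with
  | zero => simp [gaussTerm, homPoch_zero, qPoch_zero]; ring
  | succ M ih =>
    rw [sum_range_succ, ih]
    have h1 : 1 - q * q ^ M ≠ 0 := one_sub_ne_zero_of_norm_lt_one (norm_mul_pow_lt_one hq hq M)
    have h2 : 1 - c ^ 2 * q ^ M ≠ 0 :=
      one_sub_ne_zero_of_norm_lt_one (norm_mul_pow_lt_one (norm_sq_lt_one hc) hq M)
    have h3 := qPoch_ne_zero hq hq M
    have h4 := qPoch_ne_zero (norm_sq_lt_one hc) hq M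
    rw [gaussTerm, gaussTerm, gaussTerm, homPoch_mul_succ, homPoch_succ, homPoch_succ,
      qPoch_succ, qPoch_succ, pow_succ' q M]
    generalize q ^ M = y at *
    have h5 : 1 - y * q ≠ 0 := by rwa [mul_comm]
    field_simp
    ring

theorem tsum_gaussTerm_contiguous {c q : ℂ} (hq : ‖q‖ < 1) (hc : ‖c‖ < 1) {a b : ℂ}
    (hab : ‖a * b‖ < 1) :
    (1 - a * b) * ∑' m, gaussTerm c q a b m = (1 - a * c) * ∑' m, gaussTerm c q (a * q) b m := by
  have hab' : ‖a * q * b‖ < 1 := by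
    rw [mul_right_comm]; simpa using norm_mul_pow_lt_one hab hq 1
  have hs := summable_gaussTerm hq hc hab
  have hs' := summable_gaussTerm hq hc hab'
  have h1 := ((hs.hasSum.mul_left (1 - a * b)).sub
    (hs'.hasSum.mul_left (1 - a * c))).tendsto_sum_nat
  have h2 := (tendsto_add_atTop_iff_nat 1).mpr h1
  simp only [sum_gaussTerm_telescope hq hc] at h2
  have h3 : Tendsto (fun M : ℕ => -a * (b - c * q ^ M) * gaussTerm c q a b M) atTop
      (𝓝 (-a * (b - c * 0) * 0)) :=
    (((tendsto_pow_atTop_nhds_zero_of_norm_lt_one hq).const_mul c).const_sub b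
      |>.const_mul (-a)).mul hs.tendsto_atTop_zero
  rw [mul_zero] at h3
  exact sub_eq_zero.mp (tendsto_nhds_unique h2 h3)

theorem tsum_gaussTerm_iterate {c q : ℂ} (hq : ‖q‖ < 1) (hc : ‖c‖ < 1) {a b : ℂ}
    (hab : ‖a * b‖ < 1) (n : ℕ) :
    qPoch (a * b) q n * ∑' m, gaussTerm c q a b m =
      qPoch (a * c) q n * ∑' m, gaussTerm c q (a * q ^ n) b m := by
  induction n with
  | zero => simp [qPoch_zero]
  | succ n ih =>
    have hn : ‖a * q ^ n * b‖ < 1 := by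
      rw [mul_right_comm]; exact norm_mul_pow_lt_one hab hq n
    have h := tsum_gaussTerm_contiguous hq hc hn
    rw [qPoch_succ, qPoch_succ, pow_succ, ← mul_assoc a]
    linear_combination (1 - a * b * q ^ n) * ih + qPoch (a * c) q n * h

/-- Iterating the contiguous relation replaces a by a qⁿ, and n → ∞ sends it to 0. -/
theorem tsum_gaussTerm_eq_zero_left {c q : ℂ} (hq : ‖q‖ < 1) (hc : ‖c‖ < 1) {a b : ℂ}
    (hab : ‖a * b‖ < 1) :
    qPochInf (a * b) q * ∑' m, gaussTerm c q a b m =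
      qPochInf (a * c) q * ∑' m, gaussTerm c q 0 b m := by
  have hab' := hab
  rw [norm_mul] at hab'
  obtain ⟨g, hg, h⟩ := exists_norm_gaussTerm_le hq hc (norm_nonneg a) (norm_nonneg b) hab'
  have hlim : Tendsto (fun n : ℕ => ∑' m, gaussTerm c q (a * q ^ n) b m) atTop
      (𝓝 (∑' m, gaussTerm c q 0 b m)) := by
    refine tendsto_tsum_of_dominated_convergence hg (fun m => ?_) (Eventually.of_forall fun n =>
      h _ b ?_ le_rfl)
    · have hc : Continuous fun x => gaussTerm c q x b m := by
        unfold gaussTerm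
        exact ((continuous_homPoch c q m).mul_const _).div_const _
      have h0 : Tendsto (fun n : ℕ => a * q ^ n) atTop (𝓝 0) := by
        simpa using (tendsto_pow_atTop_nhds_zero_of_norm_lt_one hq).const_mul a
      exact (hc.tendsto 0).comp h0
    · rw [norm_mul, norm_pow]
      exact mul_le_of_le_one_right (norm_nonneg _) (pow_le_one₀ (norm_nonneg _) hq.le)
  have h1 := (tendsto_qPoch (a * b) hq).mul_const (∑' m, gaussTerm c q a b m)
  simp only [tsum_gaussTerm_iterate hq hc hab] at h1
  exact tendsto_nhds_unique h1 ((tendsto_qPoch (a * c) hq).mul hlim)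

theorem gaussTerm_comm (c q a b : ℂ) : gaussTerm c q a b = gaussTerm c q b a := by
  funext m
  simp only [gaussTerm, mul_comm (homPoch c a q m)]

/-- The `q`-Gauss sum, in homogeneous form. -/
theorem tsum_gaussTerm {c q : ℂ} (hq : ‖q‖ < 1) (hc : ‖c‖ < 1) {a b : ℂ} (hab : ‖a * b‖ < 1) :
    qPochInf (c ^ 2) q * qPochInf (a * b) q * ∑' m, gaussTerm c q a b m =
      qPochInf (a * c) q * qPochInf (b * c) q := by
  have hzero : qPochInf 0 q = 1 := by simp [qPochInf]
  have h0 : ∀ x : ℂ, ∑' m, gaussTerm c q 0 x m =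
      qPochInf (x * c) q * ∑' m, gaussTerm c q 0 0 m := fun x => by
    have := tsum_gaussTerm_eq_zero_left hq hc (a := x) (b := 0) (by simp)
    rwa [mul_zero, hzero, one_mul, gaussTerm_comm] at this
  -- At b = c the factor c - c kills every term with m ≥ 1. Comparing with `h0 c` evaluates the sum
  -- at (0, 0) as 1/(c²;q)_∞.
  have h1 : ∑' m, gaussTerm c q 0 c m = 1 := by
    rw [tsum_eq_single 0]
    · simp [gaussTerm, homPoch_zero, qPoch_zero]
    · intro m hm
      obtain ⟨k, rfl⟩ := Nat.exists_eq_succ_of_ne_zero hm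
      simp [gaussTerm, homPoch_self_succ]
  have h2 := h0 c
  rw [h1, ← pow_two] at h2
  rw [mul_assoc, tsum_gaussTerm_eq_zero_left hq hc hab, h0 b]
  linear_combination -(qPochInf (a * c) q * qPochInf (b * c) q) * h2

/-! ### Bilateral sums -/

/-- `1 / (q; q)_k`, extended by zero to negative `k`. -/
noncomputable def invQPoch (q : ℂ) (k : ℤ) : ℂ := if 0 ≤ k then (qPoch q q k.toNat)⁻¹ else 0

theorem invQPoch_natCast (q : ℂ) (n : ℕ) : invQPoch q n = (qPoch q q n)⁻¹ := by
  simp [invQPoch]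

theorem invQPoch_of_neg (q : ℂ) {k : ℤ} (hk : k < 0) : invQPoch q k = 0 :=
  if_neg hk.not_ge

theorem invQPoch_sub_one {q : ℂ} (hq : ‖q‖ < 1) (k : ℤ) :
    invQPoch q (k - 1) = (1 - q ^ k) * invQPoch q k := by
  rcases lt_trichotomy k 0 with hk | rfl | hk
  · rw [invQPoch_of_neg q hk, invQPoch_of_neg q (by omega), mul_zero]
  · rw [invQPoch_of_neg q (by omega), zpow_zero, sub_self, zero_mul]
  · obtain ⟨n, rfl⟩ : ∃ n : ℕ, k = n + 1 := ⟨(k - 1).toNat, by omega⟩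
    have h1 : 1 - q * q ^ n ≠ 0 := one_sub_ne_zero_of_norm_lt_one (norm_mul_pow_lt_one hq hq n)
    rw [add_sub_cancel_right, invQPoch_natCast, show (n : ℤ) + 1 = (n + 1 : ℕ) by simp,
      invQPoch_natCast, zpow_natCast, qPoch_succ, pow_succ']
    have h2 := qPoch_ne_zero hq hq n
    field_simp

/-- The terms of the bilateral sums from which the Bailey pair is computed. -/
noncomputable def bilatTerm (q : ℂ) (s k l j : ℤ) : ℂ :=
  (-1) ^ j * q ^ (3 * j ^ 2 + s * j) * (invQPoch q (k - 2 * j) * invQPoch q (l + 2 * j))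

theorem bilatTerm_eq_zero (q : ℂ) (s k l : ℤ) {j : ℤ} (hj : j ∉ Icc (-|l|) |k|) :
    bilatTerm q s k l j = 0 := by
  have h : k - 2 * j < 0 ∨ l + 2 * j < 0 := by
    by_contra! h
    have := le_abs_self k
    have := le_abs_self l
    have := abs_nonneg k
    have := abs_nonneg l
    exact hj (mem_Icc.mpr ⟨by omega, by omega⟩)
  rcases h with h | h <;> simp [bilatTerm, invQPoch_of_neg q h]

theorem summable_bilatTerm (q : ℂ) (s k l : ℤ) : Summable (bilatTerm q s k l) :=
  summable_of_ne_finset_zero fun _ hj => bilatTerm_eq_zero q s k l hj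

theorem tsum_bilatTerm_neg (q : ℂ) (s k l : ℤ) :
    ∑' j, bilatTerm q s k l j = ∑' j, bilatTerm q (-s) l k j := by
  rw [← (Equiv.neg ℤ).tsum_eq]
  refine tsum_congr fun j => ?_
  have h : (-1 : ℂ) ^ (-j) = (-1) ^ j := by rw [zpow_neg, ← inv_zpow]; norm_num
  simp only [bilatTerm, Equiv.neg_apply, h, neg_sq, neg_mul, mul_neg, sub_neg_eq_add,
    ← sub_eq_add_neg]
  ring

/-- The reflection j ↦ -1 - j fixes 3j² + 3j, swaps the two reciprocal factors and reverses the
sign, so the sum equals its negative. -/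
theorem tsum_bilatTerm_three (q : ℂ) (k : ℤ) :
    ∑' j, bilatTerm q 3 k (k + 2) j = 0 := by
  have h : ∑' j, bilatTerm q 3 k (k + 2) j = -∑' j, bilatTerm q 3 k (k + 2) j := by
    conv_lhs => rw [← (Equiv.subLeft (-1 : ℤ)).tsum_eq]
    rw [← tsum_neg]
    refine tsum_congr fun j => ?_
    have h : (-1 : ℂ) ^ (-1 - j) = -(-1) ^ j := by
      rw [zpow_sub₀ (by norm_num), div_eq_mul_inv, ← inv_zpow]; norm_num
    simp only [bilatTerm, Equiv.subLeft_apply, h]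
    rw [show 3 * (-1 - j) ^ 2 + 3 * (-1 - j) = 3 * j ^ 2 + 3 * j by ring,
      show k - 2 * (-1 - j) = k + 2 + 2 * j by ring,
      show k + 2 + 2 * (-1 - j) = k - 2 * j by ring]
    ring
  linear_combination h / 2

/-- Lowering k multiplies each term by 1 - q^(k-2j); the q^(-2j) lowers s by 2. -/
theorem tsum_bilatTerm_sub_one_left {q : ℂ} (hq0 : q ≠ 0) (hq : ‖q‖ < 1) (s k l : ℤ) :
    ∑' j, bilatTerm q s (k - 1) l j =
      ∑' j, bilatTerm q s k l j - q ^ k * ∑' j, bilatTerm q (s - 2) k l j := by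
  rw [← tsum_mul_left, ← (summable_bilatTerm q s k l).tsum_sub
    ((summable_bilatTerm q (s - 2) k l).mul_left _)]
  refine tsum_congr fun j => ?_
  have h : q ^ k * q ^ (3 * j ^ 2 + (s - 2) * j) = q ^ (3 * j ^ 2 + s * j) * q ^ (k - 2 * j) := by
    rw [← zpow_add₀ hq0, ← zpow_add₀ hq0]; ring_nf
  simp only [bilatTerm]
  rw [show k - 1 - 2 * j = k - 2 * j - 1 by ring, invQPoch_sub_one hq]
  linear_combination (-1) ^ j * (invQPoch q (k - 2 * j) * invQPoch q (l + 2 * j)) * h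

theorem tsum_bilatTerm_sub_one_right {q : ℂ} (hq0 : q ≠ 0) (hq : ‖q‖ < 1) (s k l : ℤ) :
    ∑' j, bilatTerm q s k (l - 1) j =
      ∑' j, bilatTerm q s k l j - q ^ l * ∑' j, bilatTerm q (s + 2) k l j := by
  rw [tsum_bilatTerm_neg, tsum_bilatTerm_sub_one_left hq0 hq, tsum_bilatTerm_neg q s,
    tsum_bilatTerm_neg q (s + 2), neg_add']

/-- Write S_s(k, l) for the sum and S_s for S_s(n, n+1). The vanishing of S_3(n-1, n+1) gives S_3 =
qⁿ S_1 and S_1(n-1, n) = S_1 - qⁿ S_(-1). The symmetry S_1(n, n) = S_(-1)(n, n) then expresses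
S_(-1) through S_1. -/
theorem tsum_bilatTerm_one_rec {q : ℂ} (hq0 : q ≠ 0) (hq : ‖q‖ < 1) (n : ℤ) :
    ∑' j, bilatTerm q 1 (n - 1) n j =
      (1 - q ^ n) * (1 - q ^ (2 * n + 1)) * ∑' j, bilatTerm q 1 n (n + 1) j := by
  have h1 := tsum_bilatTerm_sub_one_left hq0 hq 3 n (n + 1)
  have h2 := tsum_bilatTerm_three q (n - 1)
  have h3 := tsum_bilatTerm_sub_one_right hq0 hq 1 n (n + 1)
  have h4 := tsum_bilatTerm_sub_one_right hq0 hq (-1) n (n + 1)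
  have h5 := tsum_bilatTerm_neg q 1 n n
  have h6 := tsum_bilatTerm_sub_one_right hq0 hq 1 (n - 1) (n + 1)
  have h7 := tsum_bilatTerm_sub_one_left hq0 hq 1 n (n + 1)
  rw [show n - 1 + 2 = n + 1 by ring] at h2
  norm_num at h1 h3 h4 h6 h7
  rw [h2] at h1 h6
  rw [h7] at h6
  rw [h6, show 2 * n + 1 = n + (n + 1) by ring, zpow_add₀ hq0 n (n + 1)]
  rw [h3, h4] at h5
  linear_combination (-q ^ n * q ^ (n + 1)) * h1 + q ^ n * h5

theorem tsum_bilatTerm_one {q : ℂ} (hq0 : q ≠ 0) (hq : ‖q‖ < 1) (n : ℕ) :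
    ∑' j, bilatTerm q 1 n (n + 1) j = (qPoch q q n * qPoch q (q ^ 2) (n + 1))⁻¹ := by
  induction n with
  | zero =>
    rw [tsum_eq_single 0]
    · have := invQPoch_natCast q 0
      have := invQPoch_natCast q 1
      simp_all [bilatTerm, qPoch_zero, qPoch_succ]
    · intro j hj
      have h : (0 : ℤ) - 2 * j < 0 ∨ (0 : ℤ) + 1 + 2 * j < 0 := by omega
      rcases h with h | h <;> simp only [bilatTerm, Nat.cast_zero, invQPoch_of_neg q h] <;> simp
  | succ n ih =>
    have h := tsum_bilatTerm_one_rec hq0 hq (n + 1)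
    rw [add_sub_cancel_right, ih] at h
    have h1 : 1 - q * q ^ n ≠ 0 := one_sub_ne_zero_of_norm_lt_one (norm_mul_pow_lt_one hq hq n)
    have h2 : 1 - q * (q ^ 2) ^ (n + 1) ≠ 0 :=
      one_sub_ne_zero_of_norm_lt_one (norm_mul_pow_lt_one hq (norm_sq_lt_one hq) _)
    have h3 : q ^ ((n : ℤ) + 1) = q * q ^ n := by rw [zpow_add_one₀ hq0, zpow_natCast, mul_comm]
    have h4 : q ^ (2 * ((n : ℤ) + 1) + 1) = q * (q ^ 2) ^ (n + 1) := by
      rw [← pow_mul, ← pow_succ', ← zpow_natCast]; push_cast; ring_nf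
    rw [h3, h4] at h
    rw [Nat.cast_succ, qPoch_succ q q n, qPoch_succ _ _ (n + 1)]
    have h5 := qPoch_ne_zero hq hq n
    have h6 := qPoch_ne_zero hq (norm_sq_lt_one hq) (n + 1)
    apply mul_left_cancel₀ (mul_ne_zero h1 h2)
    rw [← h]
    generalize 1 - q * q ^ n = x at *
    generalize 1 - q * (q ^ 2) ^ (n + 1) = y at *
    field_simp

/-! ### The Bailey pair -/

/-- The numbers `α_r` of the Bailey pair. -/
noncomputable def baileyAlpha (q : ℂ) (r : ℕ) : ℂ :=
  if Even r then (-1) ^ (r / 2) * q ^ (3 * (r / 2) ^ 2 + r / 2)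
  else -((-1) ^ (r / 2) * q ^ (3 * (r / 2) ^ 2 + 5 * (r / 2) + 2))

theorem baileyAlpha_even (q : ℂ) (m : ℕ) :
    baileyAlpha q (2 * m) = (-1) ^ m * q ^ (3 * m ^ 2 + m) := by
  simp [baileyAlpha]

theorem baileyAlpha_odd (q : ℂ) (m : ℕ) :
    baileyAlpha q (2 * m + 1) = -((-1) ^ m * q ^ (3 * m ^ 2 + 5 * m + 2)) := by
  rw [baileyAlpha, if_neg (by simp), show (2 * m + 1) / 2 = m by omega]

theorem norm_baileyAlpha_le {q : ℂ} (hq : ‖q‖ < 1) (r : ℕ) : ‖baileyAlpha q r‖ ≤ 1 := by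
  unfold baileyAlpha
  split_ifs <;> simpa using pow_le_one₀ (norm_nonneg q) hq.le

/-- The index r = 2m corresponds to j = m and r = 2m + 1 to j = -(m + 1); in the odd case the two
reciprocal factors trade places. -/
theorem sum_baileyAlpha_eq_tsum (q : ℂ) (n : ℕ) :
    ∑ r ∈ range (n + 1), baileyAlpha q r * ((qPoch q q (n - r))⁻¹ * (qPoch q q (n + r + 1))⁻¹) =
      ∑' j, bilatTerm q 1 n (n + 1) j := by
  have h0 : ∀ r : ℕ, r ≤ n →
      (qPoch q q (n - r))⁻¹ * (qPoch q q (n + r + 1))⁻¹ =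
      invQPoch q (n - r) * invQPoch q (n + r + 1) := fun r hr => by
    rw [← invQPoch_natCast, ← invQPoch_natCast]
    push_cast [hr]
    rfl
  have h1 : ∑ r ∈ range (n + 1),
      baileyAlpha q r * ((qPoch q q (n - r))⁻¹ * (qPoch q q (n + r + 1))⁻¹) =
      ∑' r : ℕ, baileyAlpha q r * (invQPoch q (n - r) * invQPoch q (n + r + 1)) := by
    rw [tsum_eq_sum (s := range (n + 1))]
    · exact sum_congr rfl fun r hr => by rw [h0 r (by simpa [Nat.lt_succ_iff] using hr)]
    · intro r hr
      rw [invQPoch_of_neg q (k := n - r) (by simp at hr; omega)]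
      simp
  have he : ∀ m : ℕ, baileyAlpha q (2 * m) * (invQPoch q (n - (2 * m : ℕ)) *
      invQPoch q (n + (2 * m : ℕ) + 1)) = bilatTerm q 1 n (n + 1) m := fun m => by
    rw [baileyAlpha_even, bilatTerm, zpow_natCast, ← zpow_natCast q]
    push_cast
    ring_nf
  have ho : ∀ m : ℕ, baileyAlpha q (2 * m + 1) * (invQPoch q (n - (2 * m + 1 : ℕ)) *
      invQPoch q (n + (2 * m + 1 : ℕ) + 1)) = bilatTerm q 1 n (n + 1) (-(m + 1 : ℤ)) :=
      fun m => by
    have h : (-1 : ℂ) ^ (-(m + 1 : ℤ)) = -(-1) ^ m := by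
      rw [zpow_neg, ← inv_zpow, zpow_add_one₀ (by norm_num)]; norm_num
    rw [baileyAlpha_odd, bilatTerm, h, ← zpow_natCast q]
    push_cast
    ring_nf
  have hs := summable_bilatTerm q 1 n (n + 1)
  have hse := hs.comp_injective Nat.cast_injective
  have hso := hs.comp_injective (i := fun m : ℕ => -(m + 1 : ℤ)) fun a b h => by
    simpa using h
  rw [h1, ← tsum_even_add_odd]
  · simp only [he, ho]
    exact (tsum_of_nat_of_neg_add_one hse hso).symm
  · simpa only [he] using! hse
  · simpa only [ho] using! hso

theorem qPoch_self_succ (q : ℂ) (n : ℕ) : qPoch q q (n + 1) = (1 - q) * qPoch (q ^ 2) q n := by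
  rw [add_comm, qPoch_add]
  simp [qPoch_succ, qPoch_zero, pow_two]

/-- The Bailey pair relative to `q` with `β_n = 1 / ((q; q)_n (q³; q²)_n)`. -/
theorem sum_baileyAlpha {q : ℂ} (hq : ‖q‖ < 1) (n : ℕ) :
    ∑ r ∈ range (n + 1), baileyAlpha q r * ((qPoch q q (n - r))⁻¹ * (qPoch (q ^ 2) q (n + r))⁻¹) =
      (qPoch q q n * qPoch (q ^ 3) (q ^ 2) n)⁻¹ := by
  -- The recurrence uses integer powers of q, so q = 0 is separate: there only r = 0 contributes.
  rcases eq_or_ne q 0 with rfl | hq0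
  · have h1 : ∀ n, qPoch 0 0 n = 1 := fun n => by simp [qPoch]
    rw [sum_range_succ', sum_eq_zero]
    · simp [h1, baileyAlpha]
    · intro r _
      simp only [baileyAlpha]
      split_ifs with h
      · have : (r + 1) / 2 ≠ 0 := by rcases h with ⟨m, hm⟩; omega
        simp [this]
      · simp
  · have h := sum_baileyAlpha_eq_tsum q n
    rw [tsum_bilatTerm_one hq0 hq] at h
    have h1 : 1 - q ≠ 0 := one_sub_ne_zero_of_norm_lt_one hq
    have h2 : qPoch q (q ^ 2) (n + 1) = (1 - q) * qPoch (q ^ 3) (q ^ 2) n := by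
      rw [add_comm, qPoch_add]
      simp [qPoch_succ, qPoch_zero, ← pow_succ']
    apply mul_left_cancel₀ (inv_ne_zero h1)
    rw [h2, mul_left_comm, mul_inv] at h
    rw [← h, mul_sum]
    refine sum_congr rfl fun r _ => ?_
    rw [qPoch_self_succ, mul_inv]
    ring

/-! ### The Bailey transform -/

theorem tsum_sum_antidiagonal {f : ℕ → ℕ → ℂ} (hf : Summable fun x : ℕ × ℕ => f x.1 x.2) :
    ∑' n, ∑ x ∈ antidiagonal n, f x.1 x.2 = ∑' r, ∑' m, f r m := by
  have h := (Finset.HasAntidiagonal.sigmaAntidiagonalEquivProd (A := ℕ)).summable_iff.mpr hf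
  rw [← hf.tsum_prod, ← (Finset.HasAntidiagonal.sigmaAntidiagonalEquivProd (A := ℕ)).tsum_eq]
  refine Eq.trans (tsum_congr fun n => ?_) (h.tsum_sigma' fun n => (hasSum_fintype _).summable).symm
  rw [tsum_fintype, ← sum_coe_sort]
  rfl

/-- The double series behind the Bailey transform. -/
noncomputable def baileyTerm (q a b : ℂ) (r m : ℕ) : ℂ :=
  baileyAlpha q r * (homPoch q a q (r + m) * homPoch q b q (r + m)) *
    ((qPoch q q m)⁻¹ * (qPoch (q ^ 2) q (2 * r + m))⁻¹)

theorem summable_homPoch_mul_of_bounded {q a b : ℂ} (hq : ‖q‖ < 1) (hab : ‖a * b‖ < 1) {w : ℕ → ℂ}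
    {K : ℝ} (hw : ∀ n, ‖w n‖ ≤ K) : Summable fun n => homPoch q a q n * homPoch q b q n * w n := by
  rw [norm_mul] at hab
  obtain ⟨C, s, hs0, hs1, hC⟩ :=
    exists_norm_homPoch_mul_le hq q (norm_nonneg a) (norm_nonneg b) hab
  refine Summable.of_norm_bounded
    (((summable_geometric_of_lt_one hs0.le hs1).mul_left C).mul_right K) fun n => ?_
  have h := hC a b le_rfl le_rfl n
  rw [norm_mul]
  exact mul_le_mul h (hw n) (norm_nonneg _) ((norm_nonneg _).trans h)

theorem norm_inv_mul_inv_le {x y : ℂ} {K K' : ℝ} (hx : ‖x⁻¹‖ ≤ K) (hy : ‖y⁻¹‖ ≤ K') :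
    ‖x⁻¹ * y⁻¹‖ ≤ K * K' := by
  rw [norm_mul]
  exact mul_le_mul hx hy (norm_nonneg _) ((norm_nonneg _).trans hx)

/-- The α_r and the reciprocal factorials are bounded, while the numerators are at most C s^(r+m),
so a product of two geometric series dominates. -/
theorem summable_baileyTerm {q a b : ℂ} (hq : ‖q‖ < 1) (hab : ‖a * b‖ < 1) :
    Summable fun x : ℕ × ℕ => baileyTerm q a b x.1 x.2 := by
  rw [norm_mul] at hab
  obtain ⟨C, s, hs0, hs1, hC⟩ :=
    exists_norm_homPoch_mul_le hq q (norm_nonneg a) (norm_nonneg b) hab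
  obtain ⟨K, hK⟩ := exists_norm_inv_qPoch_le hq hq
  obtain ⟨K', hK'⟩ := exists_norm_inv_qPoch_le (norm_sq_lt_one hq) hq
  have hg := summable_geometric_of_lt_one hs0.le hs1
  refine Summable.of_norm_bounded
    (((hg.mul_of_nonneg hg (fun _ => by positivity) fun _ => by positivity).mul_left
      C).mul_right (K * K')) fun x => ?_
  have h := hC a b le_rfl le_rfl (x.1 + x.2)
  have h1 := norm_inv_mul_inv_le (hK x.2) (hK' (2 * x.1 + x.2))
  rw [pow_add] at h
  rw [baileyTerm, mul_assoc, norm_mul]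
  refine (mul_le_of_le_one_left (norm_nonneg _) (norm_baileyAlpha_le hq _)).trans ?_
  rw [norm_mul]
  exact mul_le_mul h h1 (norm_nonneg _) ((norm_nonneg _).trans h)

theorem sum_antidiagonal_baileyTerm {q : ℂ} (hq : ‖q‖ < 1) (a b : ℂ) (n : ℕ) :
    ∑ x ∈ antidiagonal n, baileyTerm q a b x.1 x.2 =
      homPoch q a q n * homPoch q b q n * (qPoch q q n * qPoch (q ^ 3) (q ^ 2) n)⁻¹ := by
  rw [Finset.Nat.sum_antidiagonal_eq_sum_range_succ (baileyTerm q a b), ← sum_baileyAlpha hq,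
    mul_sum]
  refine sum_congr rfl fun r hr => ?_
  have hr' : r ≤ n := by simpa [Nat.lt_succ_iff] using hr
  rw [baileyTerm, show r + (n - r) = n by omega, show 2 * r + (n - r) = n + r by omega]
  ring

/-- After splitting off the first r factors of each numerator and the first 2r of (q²;q)_(2r+m), the
sum over m is q-Gauss with c = q^(r+1). -/
theorem tsum_baileyTerm {q a b : ℂ} (hq : ‖q‖ < 1) (ha : ‖a * q‖ < 1) (hb : ‖b * q‖ < 1)
    (hab : ‖a * b‖ < 1) (r : ℕ) :
    qPochInf (q ^ 2) q * qPochInf (a * b) q * ∑' m, baileyTerm q a b r m =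
      qPochInf (a * q) q * qPochInf (b * q) q *
        (baileyAlpha q r * (homPoch q a q r * homPoch q b q r *
          ((qPoch (a * q) q r)⁻¹ * (qPoch (b * q) q r)⁻¹))) := by
  have h : ∀ m, baileyTerm q a b r m = baileyAlpha q r * (homPoch q a q r * homPoch q b q r) *
      (qPoch (q ^ 2) q (2 * r))⁻¹ * gaussTerm (q * q ^ r) q a b m := fun m => by
    rw [baileyTerm, homPoch_add, homPoch_add, qPoch_add, gaussTerm,
      show q ^ 2 * q ^ (2 * r) = (q * q ^ r) ^ 2 by ring, div_eq_mul_inv, mul_inv, mul_inv]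
    ring
  simp only [h, tsum_mul_left]
  have hg := tsum_gaussTerm hq (norm_mul_pow_lt_one hq hq r) hab
  rw [qPochInf_eq_qPoch_mul (q ^ 2) hq (2 * r), qPochInf_eq_qPoch_mul (a * q) hq r,
    qPochInf_eq_qPoch_mul (b * q) hq r, mul_assoc a, mul_assoc b,
    show q ^ 2 * q ^ (2 * r) = (q * q ^ r) ^ 2 by ring]
  have h1 := qPoch_ne_zero (norm_sq_lt_one hq) hq (2 * r)
  have h2 := qPoch_ne_zero ha hq r
  have h3 := qPoch_ne_zero hb hq r
  generalize qPochInf ((q * q ^ r) ^ 2) q = I₁ at *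
  generalize qPochInf (a * (q * q ^ r)) q = I₂ at *
  generalize qPochInf (b * (q * q ^ r)) q = I₃ at *
  generalize qPoch (a * q) q r = A at *
  generalize qPoch (b * q) q r = B at *
  generalize qPoch (q ^ 2) q (2 * r) = D at *
  field_simp
  linear_combination baileyAlpha q r * homPoch q a q r * homPoch q b q r * hg

/-- The Bailey lemma for the pair of `sum_baileyAlpha`. -/
theorem bailey_transform {q a b : ℂ} (hq : ‖q‖ < 1) (ha : ‖a * q‖ < 1) (hb : ‖b * q‖ < 1)
    (hab : ‖a * b‖ < 1) :
    qPochInf (q ^ 2) q * qPochInf (a * b) q *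
        ∑' n, homPoch q a q n * homPoch q b q n * (qPoch q q n * qPoch (q ^ 3) (q ^ 2) n)⁻¹ =
      qPochInf (a * q) q * qPochInf (b * q) q *
        ∑' r, baileyAlpha q r * (homPoch q a q r * homPoch q b q r *
          ((qPoch (a * q) q r)⁻¹ * (qPoch (b * q) q r)⁻¹)) := by
  simp only [← sum_antidiagonal_baileyTerm hq]
  rw [tsum_sum_antidiagonal (summable_baileyTerm hq hab), ← tsum_mul_left, ← tsum_mul_left]
  exact tsum_congr (tsum_baileyTerm hq ha hb hab)

/-! ### Specialization to base q² -/

theorem qPochPow_eq_homPoch (q a : ℂ) (n : ℕ) :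
    qPochPow q a n = homPoch (q ^ 2) a (q ^ 2) n := by
  rw [qPochPow_eq_prod, homPoch]
  exact prod_congr rfl fun k _ => by ring

theorem qPoch_mul_qPoch_neg (x q : ℂ) (n : ℕ) :
    qPoch x q n * qPoch (-x) q n = qPoch (x ^ 2) (q ^ 2) n := by
  simp only [qPoch, ← prod_mul_distrib]
  exact prod_congr rfl fun k _ => by ring

theorem theoremT7 (q a b : ℂ) (hq : ‖q‖ < 1)
    (ha : ‖a * q ^ 2‖ < 1) (hb : ‖b * q ^ 2‖ < 1) (hab : ‖a * b‖ < 1) :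
    Summable (fun n : ℕ => qPochPow q a n * qPochPow q b n /
      (qPoch (q ^ 2) (q ^ 2) n * qPoch (q ^ 3) (q ^ 2) n * qPoch (-q ^ 3) (q ^ 2) n)) ∧
    Summable (fun n : ℕ => (-1 : ℂ) ^ n *
      (qPochPow q a (2 * n) * qPochPow q b (2 * n) /
        (qPoch (a * q ^ 2) (q ^ 2) (2 * n) * qPoch (b * q ^ 2) (q ^ 2) (2 * n))) *
      q ^ (6 * n ^ 2 + 2 * n)) ∧
    Summable (fun n : ℕ => (-1 : ℂ) ^ n *
      (qPochPow q a (2 * n + 1) * qPochPow q b (2 * n + 1) /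
        (qPoch (a * q ^ 2) (q ^ 2) (2 * n + 1) * qPoch (b * q ^ 2) (q ^ 2) (2 * n + 1))) *
      q ^ (6 * n ^ 2 + 10 * n + 4)) ∧
    qPochInf (q ^ 4) (q ^ 2) * qPochInf (a * b) (q ^ 2) /
        (qPochInf (-q ^ 2) (q ^ 2) * qPochInf (a * q ^ 2) (q ^ 2) *
          qPochInf (b * q ^ 2) (q ^ 2) * qPochInf (q ^ 2) (q ^ 4)) *
      ∑' n : ℕ, qPochPow q a n * qPochPow q b n /
        (qPoch (q ^ 2) (q ^ 2) n * qPoch (q ^ 3) (q ^ 2) n * qPoch (-q ^ 3) (q ^ 2) n) =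
    (∑' n : ℕ, (-1 : ℂ) ^ n *
      (qPochPow q a (2 * n) * qPochPow q b (2 * n) /
        (qPoch (a * q ^ 2) (q ^ 2) (2 * n) * qPoch (b * q ^ 2) (q ^ 2) (2 * n))) *
      q ^ (6 * n ^ 2 + 2 * n)) -
    ∑' n : ℕ, (-1 : ℂ) ^ n *
      (qPochPow q a (2 * n + 1) * qPochPow q b (2 * n + 1) /
        (qPoch (a * q ^ 2) (q ^ 2) (2 * n + 1) * qPoch (b * q ^ 2) (q ^ 2) (2 * n + 1))) *
      q ^ (6 * n ^ 2 + 10 * n + 4) := by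
  have hp := norm_sq_lt_one hq
  have hp2 := norm_sq_lt_one hp
  have hp3 : ‖(q ^ 2) ^ 3‖ < 1 := by
    rw [norm_pow]
    exact pow_lt_one₀ (norm_nonneg _) hp three_ne_zero
  obtain ⟨K₁, hK₁⟩ := exists_norm_inv_qPoch_le hp hp
  obtain ⟨K₂, hK₂⟩ := exists_norm_inv_qPoch_le hp3 hp2
  obtain ⟨K₃, hK₃⟩ := exists_norm_inv_qPoch_le ha hp
  obtain ⟨K₄, hK₄⟩ := exists_norm_inv_qPoch_le hb hp
  have hβ : ∀ n, qPochPow q a n * qPochPow q b n /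
      (qPoch (q ^ 2) (q ^ 2) n * qPoch (q ^ 3) (q ^ 2) n * qPoch (-q ^ 3) (q ^ 2) n) =
      homPoch (q ^ 2) a (q ^ 2) n * homPoch (q ^ 2) b (q ^ 2) n *
        (qPoch (q ^ 2) (q ^ 2) n * qPoch ((q ^ 2) ^ 3) ((q ^ 2) ^ 2) n)⁻¹ := fun n => by
    rw [qPochPow_eq_homPoch, qPochPow_eq_homPoch, mul_assoc (qPoch _ _ _), qPoch_mul_qPoch_neg,
      div_eq_mul_inv, show (q ^ 3) ^ 2 = (q ^ 2) ^ 3 by ring]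
  set F : ℕ → ℂ := fun r => baileyAlpha (q ^ 2) r *
    (homPoch (q ^ 2) a (q ^ 2) r * homPoch (q ^ 2) b (q ^ 2) r *
      ((qPoch (a * q ^ 2) (q ^ 2) r)⁻¹ * (qPoch (b * q ^ 2) (q ^ 2) r)⁻¹)) with hF
  have hsF : Summable F := by
    refine (summable_homPoch_mul_of_bounded hp hab (K := K₃ * K₄) (w := fun r =>
      baileyAlpha (q ^ 2) r * ((qPoch (a * q ^ 2) (q ^ 2) r)⁻¹ *
        (qPoch (b * q ^ 2) (q ^ 2) r)⁻¹)) fun r => ?_).congr fun r => ?_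
    · rw [norm_mul]
      exact (mul_le_of_le_one_left (norm_nonneg _) (norm_baileyAlpha_le hp r)).trans
        (norm_inv_mul_inv_le (hK₃ r) (hK₄ r))
    · simp only [hF]; ring
  have he : ∀ n : ℕ, (-1 : ℂ) ^ n *
      (qPochPow q a (2 * n) * qPochPow q b (2 * n) /
        (qPoch (a * q ^ 2) (q ^ 2) (2 * n) * qPoch (b * q ^ 2) (q ^ 2) (2 * n))) *
      q ^ (6 * n ^ 2 + 2 * n) = F (2 * n) := fun n => by
    simp only [hF]
    rw [baileyAlpha_even, qPochPow_eq_homPoch, qPochPow_eq_homPoch, ← pow_mul, div_eq_mul_inv,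
      mul_inv, show 2 * (3 * n ^ 2 + n) = 6 * n ^ 2 + 2 * n by ring]
    ring
  have ho : ∀ n : ℕ, (-1 : ℂ) ^ n *
      (qPochPow q a (2 * n + 1) * qPochPow q b (2 * n + 1) /
        (qPoch (a * q ^ 2) (q ^ 2) (2 * n + 1) * qPoch (b * q ^ 2) (q ^ 2) (2 * n + 1))) *
      q ^ (6 * n ^ 2 + 10 * n + 4) = -F (2 * n + 1) := fun n => by
    simp only [hF]
    rw [baileyAlpha_odd, qPochPow_eq_homPoch, qPochPow_eq_homPoch, ← pow_mul, div_eq_mul_inv,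
      mul_inv, show 2 * (3 * n ^ 2 + 5 * n + 2) = 6 * n ^ 2 + 10 * n + 4 by ring]
    ring
  have hse : Summable fun n => F (2 * n) := hsF.comp_injective fun m n h => by
    simpa using h
  have hso : Summable fun n => F (2 * n + 1) := hsF.comp_injective fun m n h => by
    simpa using h
  simp only [hβ, he, ho]
  refine ⟨summable_homPoch_mul_of_bounded hp hab (K := K₁ * K₂) fun n => ?_, hse, hso.neg, ?_⟩
  · rw [mul_inv]
    exact norm_inv_mul_inv_le (hK₁ n) (hK₂ n)
  · have hE := qPochInf_neg_mul_qPochInf_sq hp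
    have hT := bailey_transform hp ha hb hab
    have h1 := qPochInf_ne_zero ha hp
    have h2 := qPochInf_ne_zero hb hp
    rw [tsum_neg, sub_neg_eq_add, tsum_even_add_odd hse hso,
      show q ^ 4 = (q ^ 2) ^ 2 by ring,
      show qPochInf (-q ^ 2) (q ^ 2) * qPochInf (a * q ^ 2) (q ^ 2) *
          qPochInf (b * q ^ 2) (q ^ 2) * qPochInf (q ^ 2) ((q ^ 2) ^ 2) =
        qPochInf (a * q ^ 2) (q ^ 2) * qPochInf (b * q ^ 2) (q ^ 2) by
          linear_combination qPochInf (a * q ^ 2) (q ^ 2) * qPochInf (b * q ^ 2) (q ^ 2) * hE,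
      div_mul_eq_mul_div, hT, mul_div_cancel_left₀ _ (mul_ne_zero h1 h2)]
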